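/- **Definitions.** An alphabet is a finite set. Let $\Sigma$ (terminals) and $V$ (non-terminals) be alphabets. A *table* is a finite set of context-free rules $X\to u$ with $X\in V$, $u\in(\Sigma\cup V)^\star$, containing at least one rule for each $X\in V$; $w\to^\tau w'$ means that $w'$ is obtained from $w$ by replacing every occurrence of every non-terminal according to some rule of the table $\tau$ (chosen independently for each occurrence), and $\to^{\tau_1\cdots\tau_k}$ is the successive application of $\tau_1,\dots,\tau_k$ in this order. An *ET0L grammar* $G=(\Sigma,V,T,\mathcal R,S)$ consists of such alphabets, a finite set $T$ of tables, a regular language $\mathcal R\subseteq T^\star$ (the rational control) and a start symbol $S\in V$; it generates $L(G)=\{w\in\Sigma^\star : S\to^{v}w \text{ for some } v\in\mathcal R\}$. A language is *ET0L* if it equals $L(G)$ for some ET0L grammar $G$. A *check-stack pushdown (cspd) automaton* $(Q,\Sigma,\Gamma,\Delta,\mathfrak b,\mathcal R,\theta,q_0,F)$ consists of a finite set $Q$ of states, input, pushdown and check-stack alphabets $\Sigma,\Gamma,\Delta$, a bottom symbol $\mathfrak b\notin\Delta\cup\Gamma$, a regular language $\mathcal R\subseteq\Delta^\star$ of allowed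 check-stacks, a start state $q_0\in Q$, a set $F\subseteq Q$ of accepting states and a finite set $\theta$ of transitions, each of one of the following three forms, with $p,q\in Q$, $a\in\Sigma\cup\{\varepsilon\}$, $u\in\Gamma^\star$. The machine starts in state $q_0$ at the first letter of its input, with check-stack $\mathfrak b c$ for a nondeterministically chosen $c\in\mathcal R$ (bottom at the left), which then stays fixed, and with pushdown $\mathfrak b$. The positions seen on the two stacks are always at the same height, namely that of the top of the pushdown; when the pushdown is higher than the check-stack, no check-stack letter is seen. In state $p$, each transition consumes $a$ from the input and moves to state $q$: 1. $((p,a,(\mathfrak b,\mathfrak b)),(q,u\mathfrak b))$ applies if $\mathfrak b$ is seen on both stacks, and pushes $u$; 2. $((p,a,(d,g)),(q,u))$ with $d\in\Delta$, $g\in\Gamma$ applies if $d$ is seen on the check-stack and $g$ on the pushdown, pops $g$ and then pushes $u$; 3. $((p,a,(\varepsilon,\varepsilon)),(q,u))$ applies whatever is seen on the stacks, and pushes $u$. Words are pushed beginning with their last letter. The machine recognises the language of those words for which, for some choice of $c\in\mathcal R$ and of transitions, it reaches a state in $F$ with all of its input consumed (whatever the pushdown contains). **Theorem.** Let $\Sigma$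 be an alphabet. A language $L\subseteq\Sigma^\star$ is ET0L if and only if it is recognised by a cspd automaton. -/

import Mathlib

universe u

/-- A table over the set `A` of all letters, with set of non-terminals `V`: a finite set of
context-free replacement rules, `(X, u)` standing for `X → u`, in which every non-terminal has at
least one replacement. -/
structure ET0LTable (A : Type u) (V : Set A) where
  /-- The replacement rules. -/
  rules : Set (A × List A)
  /-- There are finitely many rules. -/
  finite_rules : rules.Finite
  /-- Only non-terminals are replaced. -/
  left_mem : ∀ r ∈ rules, r.1 ∈ V
  /-- Every non-terminal has at least one replacement. -/
  exists_rule : ∀ X ∈ V, ∃ u, (X, u) ∈ rules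

namespace ET0LTable

variable {A : Type u} {V : Set A}

/-- A single occurrence of the letter `x` may become `u`: a non-terminal is replaced according to
some rule of the table, and any other letter is left as it is. -/
def Replaces (τ : ET0LTable A V) (x : A) (u : List A) : Prop :=
  (x ∈ V ∧ (x, u) ∈ τ.rules) ∨ (x ∉ V ∧ u = [x])

/-- `τ.Step w w'` is `w →^τ w'`: the table is applied to all the letters of `w` in parallel, the
rule being chosen independently for each occurrence. -/
inductive Step (τ : ET0LTable A V) : List A → List A → Prop
  | nil : Step τ [] []
  | cons {x : A} {u w w' : List A} (hx : τ.Replaces x u) (hw : Step τ w w') :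
      Step τ (x :: w) (u ++ w')

end ET0LTable

/-- An ET0L grammar with terminal alphabet `σ` and with rational control. The sets of terminals and
of non-terminals may be disjoint, but they are not required to be: both are subsets of the
alphabet `A` which is their union, and `terminal` is the inclusion of the terminals. -/
structure ET0LGrammar (σ : Type u) where
  /-- The letters: terminals and non-terminals. -/
  A : Type u
  /-- There are finitely many letters. -/
  finite_A : Finite A
  /-- The inclusion of the terminals in the letters. -/
  terminal : σ ↪ A
  /-- The set of non-terminals. -/
  V : Set A
  /-- Every letter is a terminal or a non-terminal. -/
  terminal_or_mem : ∀ a : A, a ∈ Set.range terminal ∨ a ∈ V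
  /-- The set of tables. -/
  tables : Set (ET0LTable A V)
  /-- There are finitely many tables. -/
  finite_tables : tables.Finite
  /-- The rational control, a language over the set of tables. -/
  control : Language tables
  /-- The rational control is a regular language. -/
  regular_control : control.IsRegular
  /-- The start symbol. -/
  start : A
  /-- The start symbol is a non-terminal. -/
  start_mem : start ∈ V

namespace ET0LGrammar

variable {σ : Type u}

/-- `G.Derives [τ₁, …, τₖ] w w'` is `w →^{τ₁ ⋯ τₖ} w'`; tables are applied from left to right. -/
def Derives (G : ET0LGrammar σ) : List G.tables → List G.A → List G.A → Prop
  | [], w, w' => w = w'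
  | τ :: τs, w, w' => ∃ w₁, τ.1.Step w w₁ ∧ G.Derives τs w₁ w'

/-- The language generated by the grammar: the words of terminals that are derived from the start
symbol by some sequence of tables belonging to the rational control. -/
def language (G : ET0LGrammar σ) : Language σ :=
  {w : List σ | ∃ v ∈ G.control, G.Derives v [G.start] (w.map G.terminal)}

end ET0LGrammar

/-- A language is ET0L if it is generated by some ET0L grammar. -/
def IsET0L {σ : Type u} (L : Language σ) : Prop :=
  ∃ G : ET0LGrammar σ, G.language = L

/-- What a transition of a check-stack pushdown automaton requires the read-head of the two stacks
to see: the bottom symbol on both stacks, that is `(𝔟, 𝔟)`; the letter `d` on the check-stack and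
the letter `g` on the pushdown, that is `(d, g)`; or no requirement, that is `(ε, ε)`. -/
inductive CSPDTest (Δ Γ : Type u) : Type u
  | bottom : CSPDTest Δ Γ
  | letters (d : Δ) (g : Γ) : CSPDTest Δ Γ
  | free : CSPDTest Δ Γ

/-- A check-stack pushdown automaton with input alphabet `σ`. The bottom of stack symbol is not a
letter of `Δ` or of `Γ` and is kept implicit: a transition `((p, a, (𝔟, 𝔟)), (q, w𝔟))`, with `w` a
word over `Γ`, is represented by `((p, a, .bottom), (q, w))`. The input label `none` is `ε`. -/
structure CSPDAutomaton (σ : Type u) where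
  /-- The states. -/
  Q : Type u
  /-- The alphabet for the pushdown. -/
  Γ : Type u
  /-- The alphabet for the check-stack. -/
  Δ : Type u
  /-- There are finitely many states. -/
  finite_Q : Finite Q
  /-- The pushdown alphabet is finite. -/
  finite_Γ : Finite Γ
  /-- The check-stack alphabet is finite. -/
  finite_Δ : Finite Δ
  /-- The language of allowed check-stacks. -/
  checkStacks : Language Δ
  /-- The language of allowed check-stacks is regular. -/
  regular_checkStacks : checkStacks.IsRegular
  /-- The transition relation. -/
  θ : Set ((Q × Option σ × CSPDTest Δ Γ) × (Q × List Γ))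
  /-- The transition relation is finite. -/
  finite_θ : θ.Finite
  /-- The start state. -/
  q₀ : Q
  /-- The accepting states. -/
  F : Set Q

namespace CSPDAutomaton

variable {σ : Type u}

/-- A configuration in the second stage of the execution, in which the check-stack is fixed. -/
structure Config (M : CSPDAutomaton σ) where
  /-- The current state. -/
  state : M.Q
  /-- The part of the input that has not been consumed. -/
  input : List σ
  /-- The pushdown from its top downwards, without the symbol `𝔟` at its bottom. -/
  pushdown : List M.Γ

/-- `M.Step c` is one move of the machine whose check-stack contains `𝔟c`, where `𝔟` is at the
bottom. The read-head is at the same height on the two stacks, so if the pushdown contains `gs𝔟`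
with top letter `g`, then the letter seen on the check-stack is the letter of `c` at the (zero-based)
index `|s|`; above the top of the check-stack no letter of it is seen. The word `u` is pushed
beginning with its last letter. -/
inductive Step (M : CSPDAutomaton σ) (c : List M.Δ) : M.Config → M.Config → Prop
  | bottom {p q : M.Q} {a : Option σ} {u : List M.Γ} {x : List σ}
      (h : ((p, a, .bottom), (q, u)) ∈ M.θ) :
      Step M c ⟨p, a.toList ++ x, []⟩ ⟨q, x, u⟩
  | letters {p q : M.Q} {a : Option σ} {d : M.Δ} {g : M.Γ} {u : List M.Γ} {x : List σ}
      {s : List M.Γ} (h : ((p, a, .letters d g), (q, u)) ∈ M.θ) (hd : getElem? c s.length = some d) :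
      Step M c ⟨p, a.toList ++ x, g :: s⟩ ⟨q, x, u ++ s⟩
  | free {p q : M.Q} {a : Option σ} {u : List M.Γ} {x : List σ} {s : List M.Γ}
      (h : ((p, a, .free), (q, u)) ∈ M.θ) :
      Step M c ⟨p, a.toList ++ x, s⟩ ⟨q, x, u ++ s⟩

/-- The language recognised by the machine: the words `x` for which, with some allowed check-stack,
it can reach an accepting state with all of its input consumed, starting in the start state with
input `x` and with only `𝔟` on its pushdown. -/
def language (M : CSPDAutomaton σ) : Language σ :=
  {x : List σ | ∃ c ∈ M.checkStacks, ∃ q ∈ M.F, ∃ s : List M.Γ,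
    Relation.ReflTransGen (M.Step c) ⟨M.q₀, x, []⟩ ⟨q, [], s⟩}

end CSPDAutomaton

/-- A language is recognised by some check-stack pushdown automaton. -/
def IsCSPDRecognisable {σ : Type u} (L : Language σ) : Prop :=
  ∃ M : CSPDAutomaton σ, M.language = L

/-! Each model simulates the other.

From a grammar to an automaton: the check-stack carries the control word `v`, closed by a marker,
and the derivation is run depth first. A pushdown letter is a word of bounded length, and its height
`i` records that the tables of `v` from index `i` on are still to be applied to it. Expanding its
first letter by the table seen puts the replacement one level higher, above the rest of the word. At
the height of the marker no table is left, so the letters found there are matched with the input.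
The two inclusions are `derives_or_yields_of_reaches` and `reaches_of_derives`.

From an automaton to a grammar: the automaton is first normalised to a `LetterMachine`. The bottom
symbols become ordinary letters, and the check-stack is padded at its top, which is harmless because
a finite run reaches only a bounded height (`language_toLetterMachine`). The triple construction for
pushdown automata then applies. To remove `w ++ [g]`, the machine removes `w` over the part of the
check-stack above `g`, makes a move on `g` that pushes some `u`, and removes `u` at the height of
`g`; this recursion is `Pops`. The tables of the grammar climb the check-stack: at a letter `d`, the
table of `d` may be repeated, since the number of successive moves at one height is unbounded, while
the symbols for the words above wait for promotion. `Means` gives each symbol the set of inputs it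
stands for. Tables respect it backwards (`meansWord_of_derives`), and every meaning can be realised
height by height (`MeansWord.advances`, `MeansWord.exists_derives`). -/

/-! ### Closure properties of regular languages -/

namespace Language

variable {α β : Type*}

/-- A language is regular if membership in it can be decided by reading the word letter by letter
through a finite family of languages, the residuals. -/
theorem isRegular_of_residuals {S : Type*} [Finite S] {K : Language α} (R : S → Language α)
    (step : S → α → S → Prop)
    (hstep : ∀ s a x, a :: x ∈ R s ↔ ∃ s', step s a s' ∧ x ∈ R s') (s₀ : S) (hK : R s₀ = K) :
    K.IsRegular := by
  classical
  let M : NFA α S := ⟨fun s a => {s' | step s a s'}, {s₀}, {s | [] ∈ R s}⟩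
  -- Reading a letter turns one state into a set of states, so the induction needs arbitrary `T`.
  have key : ∀ x (T : Set S), x ∈ M.acceptsFrom T ↔ ∃ s ∈ T, x ∈ R s := by
    intro x
    induction x with
    | nil => intro T; rw [NFA.nil_mem_acceptsFrom]; rfl
    | cons a x ih =>
      intro T
      rw [NFA.cons_mem_acceptsFrom, ih]
      simp only [NFA.mem_stepSet, hstep]
      constructor
      · rintro ⟨s', ⟨s, hs, h⟩, hx⟩
        exact ⟨s, hs, s', h, hx⟩
      · rintro ⟨s, hs, s', h, hx⟩
        exact ⟨s', ⟨s, hs, h⟩, hx⟩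
  have := Fintype.ofFinite S
  refine isRegular_iff.2 ⟨Set S, inferInstance, M.toDFA, ?_⟩
  rw [NFA.toDFA_correct]
  ext x
  rw [NFA.accepts_eq_acceptsFrom_start, key, ← hK]
  simp [M]

theorem isRegular_singleton_singleton (a : α) : ({[a]} : Language α).IsRegular := by
  refine isRegular_of_residuals (S := Bool) (fun b => bif b then {[]} else {[a]})
    (fun b x b' => b = false ∧ b' = true ∧ x = a) ?_ false rfl
  rintro (_ | _) x w
  · change x :: w = [a] ↔ _
    simp only [List.cons.injEq, true_and]
    constructor
    · rintro ⟨rfl, rfl⟩; exact ⟨true, ⟨rfl, rfl⟩, rfl⟩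
    · rintro ⟨b', ⟨rfl, rfl⟩, h⟩; exact ⟨rfl, h⟩
  · change x :: w = [] ↔ _
    simp

/-- The powers of a single letter. -/
def powers (a : α) : Language α := {x | ∃ n, x = List.replicate n a}

theorem isRegular_powers (a : α) : (powers a).IsRegular := by
  refine isRegular_of_residuals (S := Unit) (fun _ => powers a)
    (fun _ x _ => x = a) ?_ () rfl
  intro _ x w
  constructor
  · rintro ⟨n, hn⟩
    cases n with
    | zero => simp at hn
    | succ n =>
      rw [List.replicate_succ, List.cons.injEq] at hn
      exact ⟨(), hn.1, n, hn.2⟩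
  · rintro ⟨_, rfl, n, rfl⟩
    exact ⟨n + 1, rfl⟩

theorem IsRegular.map {L : Language α} (hL : L.IsRegular) (f : α → β) :
    (Language.map f L).IsRegular := by
  obtain ⟨S, _, M, rfl⟩ := hL
  refine isRegular_of_residuals (fun s => {x | ∃ c, M.evalFrom s c ∈ M.accept ∧ c.map f = x})
    (fun s b s' => ∃ a, f a = b ∧ M.step s a = s') ?_ M.start rfl
  intro s b x
  constructor
  · rintro ⟨c, hc, h⟩
    obtain ⟨a, c, rfl, rfl, rfl⟩ := List.map_eq_cons_iff.1 h
    exact ⟨_, ⟨a, rfl, rfl⟩, c, hc, rfl⟩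
  · rintro ⟨_, ⟨a, rfl, rfl⟩, c, hc, rfl⟩
    exact ⟨a :: c, hc, rfl⟩

theorem IsRegular.mul {L K : Language α} (hL : L.IsRegular) (hK : K.IsRegular) :
    (L * K).IsRegular := by
  obtain ⟨S, _, M, rfl⟩ := hL
  obtain ⟨T, _, N, rfl⟩ := hK
  -- There are no silent moves: the passage to the second factor happens while reading its first
  -- letter, from an accepting state of the first automaton.
  refine isRegular_of_residuals (S := S ⊕ T)
    (Sum.elim (fun s => M.acceptsFrom s * N.accepts) (fun t => N.acceptsFrom t))
    (fun r a r' => Sum.elim (fun s => r' = .inl (M.step s a) ∨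
      s ∈ M.accept ∧ r' = .inr (N.step N.start a)) (fun t => r' = .inr (N.step t a)) r) ?_
    (.inl M.start) rfl
  rintro (s | t) a x
  · simp only [Sum.elim_inl, Language.mem_mul]
    constructor
    · rintro ⟨u, hu, v, hv, h⟩
      cases u with
      | nil =>
        obtain rfl : v = a :: x := h
        exact ⟨_, .inr ⟨hu, rfl⟩, hv⟩
      | cons b u =>
        obtain ⟨rfl, rfl⟩ := List.cons.inj h
        exact ⟨_, .inl rfl, Language.mem_mul.2 ⟨u, hu, v, hv, rfl⟩⟩
    · rintro ⟨_, rfl | ⟨hs, rfl⟩, hx⟩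
      · obtain ⟨u, hu, v, hv, rfl⟩ := Language.mem_mul.1 hx
        exact ⟨a :: u, hu, v, hv, rfl⟩
      · exact ⟨[], hs, a :: x, hx, rfl⟩
  · exact ⟨fun h => ⟨_, rfl, h⟩, by rintro ⟨_, rfl, h⟩; exact h⟩

/-- `Interleaved T P [d₁, …, dₖ]` consists of the words `T d₁ ⋯ T d₁ P ⋯ T dₖ ⋯ T dₖ P`, each
`T dᵢ` being repeated any number of times. -/
inductive Interleaved (T : α → β) (P : β) : List α → List β → Prop
  | nil : Interleaved T P [] []
  | next {d : α} {c : List α} {t : List β} (h : Interleaved T P c t) :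
      Interleaved T P (d :: c) (P :: t)
  | stay {d : α} {c : List α} {t : List β} (h : Interleaved T P (d :: c) t) :
      Interleaved T P (d :: c) (T d :: t)

theorem IsRegular.interleaved [Finite α] {L : Language α} (hL : L.IsRegular) (T : α → β) (P : β) :
    Language.IsRegular {t : List β | ∃ c ∈ L, Interleaved T P c t} := by
  obtain ⟨S, _, M, rfl⟩ := hL
  -- The second component remembers the letter to which the symbols `T d` read since the last `P`
  -- commit the word. The letter `d` is guessed at each step, so `T` need not be injective, nor `P`
  -- outside its range.
  refine isRegular_of_residuals (S := S × Option α)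
    (fun r => {t | ∃ c ∈ M.acceptsFrom r.1, (∀ d ∈ r.2, ∃ c', c = d :: c') ∧ Interleaved T P c t})
    (fun r b r' => ∃ d, (∀ e ∈ r.2, e = d) ∧
      (b = P ∧ r' = (M.step r.1 d, none) ∨ b = T d ∧ r' = (r.1, some d))) ?_ (M.start, none) ?_
  · rintro ⟨s, o⟩ b t
    constructor
    · rintro ⟨c, hc, ho, h⟩
      cases h with
      | @next d c t h =>
        refine ⟨_, ⟨d, ?_, .inl ⟨rfl, rfl⟩⟩, c, hc, by simp, h⟩
        intro e he
        obtain ⟨c', hc'⟩ := ho e he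
        exact (List.cons.inj hc').1.symm
      | @stay d c t h =>
        refine ⟨_, ⟨d, ?_, .inr ⟨rfl, rfl⟩⟩, d :: c, hc, by simp, h⟩
        intro e he
        obtain ⟨c', hc'⟩ := ho e he
        exact (List.cons.inj hc').1.symm
    · rintro ⟨_, ⟨d, ho, ⟨rfl, rfl⟩ | ⟨rfl, rfl⟩⟩, c, hc, hd, h⟩
      · refine ⟨d :: c, hc, ?_, h.next⟩
        intro e he
        exact ⟨c, by rw [ho e he]⟩
      · obtain ⟨c, rfl⟩ := hd d rfl
        refine ⟨d :: c, hc, ?_, h.stay⟩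
        intro e he
        exact ⟨c, by rw [ho e he]⟩
  · ext t
    constructor
    · rintro ⟨c, hc, -, h⟩; exact ⟨c, hc, h⟩
    · rintro ⟨c, hc, h⟩; exact ⟨c, hc, by simp, h⟩

end Language

/-! ### Parallel rewriting splits along concatenation -/

namespace ET0LTable

variable {A : Type u} {V : Set A} {τ : ET0LTable A V}

theorem step_nil_iff {w : List A} : τ.Step [] w ↔ w = [] :=
  ⟨fun h => by cases h; rfl, fun h => by rw [h]; exact .nil⟩

theorem step_cons_iff {x : A} {w w' : List A} :
    τ.Step (x :: w) w' ↔ ∃ u v, w' = u ++ v ∧ τ.Replaces x u ∧ τ.Step w v :=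
  ⟨fun h => by cases h with | cons hx hw => exact ⟨_, _, rfl, hx, hw⟩,
    fun ⟨_, _, h, hx, hw⟩ => h ▸ .cons hx hw⟩

theorem step_append_iff {w₁ w₂ w' : List A} :
    τ.Step (w₁ ++ w₂) w' ↔ ∃ u v, w' = u ++ v ∧ τ.Step w₁ u ∧ τ.Step w₂ v := by
  induction w₁ generalizing w' with
  | nil => simp [step_nil_iff]
  | cons x w₁ ih =>
    simp only [List.cons_append, step_cons_iff, ih]
    constructor
    · rintro ⟨u, _, rfl, hx, v, v', rfl, h₁, h₂⟩
      exact ⟨u ++ v, v', by simp, ⟨u, v, rfl, hx, h₁⟩, h₂⟩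
    · rintro ⟨_, v', rfl, ⟨u, v, rfl, hx, h₁⟩, h₂⟩
      exact ⟨u, v ++ v', by simp, hx, v, v', rfl, h₁, h₂⟩

theorem Step.append {w₁ w₂ u v : List A} (h₁ : τ.Step w₁ u) (h₂ : τ.Step w₂ v) :
    τ.Step (w₁ ++ w₂) (u ++ v) :=
  step_append_iff.2 ⟨u, v, rfl, h₁, h₂⟩

theorem step_singleton {x : A} {u : List A} (h : τ.Replaces x u) : τ.Step [x] u := by
  simpa using Step.cons h .nil

/-- The words that a table substitutes for single letters have bounded length. -/
theorem exists_length_le [Finite A] {T : Set (ET0LTable A V)} (hT : T.Finite) :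
    ∃ N, 1 ≤ N ∧ ∀ τ ∈ T, ∀ x u, τ.Replaces x u → u.length ≤ N := by
  have hfin : (⋃ τ ∈ T, (fun r : A × List A => r.2.length) '' τ.rules).Finite :=
    hT.biUnion fun τ _ => τ.finite_rules.image _
  obtain ⟨N, hN⟩ := hfin.bddAbove
  -- The 1 accounts for letters that are not replaced, and later for the start word.
  refine ⟨max N 1, le_max_right _ _, ?_⟩
  rintro τ hτ x u (⟨-, h⟩ | ⟨-, rfl⟩)
  · exact le_max_of_le_left (hN (Set.mem_biUnion hτ ⟨_, h, rfl⟩))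
  · exact le_max_right _ _

end ET0LTable

namespace ET0LGrammar

variable {σ : Type u} {G : ET0LGrammar σ}

theorem derives_nil_iff {v : List G.tables} {w : List G.A} : G.Derives v [] w ↔ w = [] := by
  induction v with
  | nil => exact eq_comm
  | cons τ v ih => simp [Derives, ET0LTable.step_nil_iff, ih]

theorem derives_append_iff {v : List G.tables} {w₁ w₂ w' : List G.A} :
    G.Derives v (w₁ ++ w₂) w' ↔ ∃ u₁ u₂, w' = u₁ ++ u₂ ∧ G.Derives v w₁ u₁ ∧ G.Derives v w₂ u₂ := by
  induction v generalizing w₁ w₂ with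
  | nil =>
    constructor
    · rintro rfl; exact ⟨w₁, w₂, rfl, rfl, rfl⟩
    · rintro ⟨u₁, u₂, rfl, rfl, rfl⟩; rfl
  | cons τ v ih =>
    constructor
    · rintro ⟨_, hs, h⟩
      obtain ⟨u, u', rfl, h₁, h₂⟩ := ET0LTable.step_append_iff.1 hs
      obtain ⟨u₁, u₂, rfl, k₁, k₂⟩ := ih.1 h
      exact ⟨u₁, u₂, rfl, ⟨u, h₁, k₁⟩, ⟨u', h₂, k₂⟩⟩
    · rintro ⟨u₁, u₂, rfl, ⟨u, h₁, k₁⟩, ⟨u', h₂, k₂⟩⟩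
      exact ⟨u ++ u', h₁.append h₂, ih.2 ⟨u₁, u₂, rfl, k₁, k₂⟩⟩

end ET0LGrammar

/-! ### From a grammar to a check-stack pushdown automaton -/

instance CSPDTest.instFinite {Δ Γ : Type u} [Finite Δ] [Finite Γ] : Finite (CSPDTest Δ Γ) := by
  refine Finite.of_surjective (α := Option (Option (Δ × Γ)))
    (fun o => match o with
      | none => .free
      | some none => .bottom
      | some (some (d, g)) => .letters d g) ?_
  rintro (_ | ⟨d, g⟩ | _)
  · exact ⟨some none, rfl⟩
  · exact ⟨some (some (d, g)), rfl⟩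
  · exact ⟨none, rfl⟩

namespace ET0LGrammar

variable {σ : Type u} (G : ET0LGrammar σ) (N : ℕ)

/-- The pushdown letters of `G.toCSPD`: words of bounded length that remain to be rewritten, the
height at which they stand being the number of tables that have been applied to them. -/
abbrev BoundedWord : Type u := {w : List G.A // w.length ≤ N}

/-- The transitions of `G.toCSPD`. The check-stack is a sequence of tables closed by a marker. -/
inductive Transition (hN : 1 ≤ N) : (ULift.{u} (Fin 3) × Option σ ×
    CSPDTest (Option G.tables) (G.BoundedWord N)) × (ULift.{u} (Fin 3) × List (G.BoundedWord N)) →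
    Prop
  | start : Transition hN ((⟨0⟩, none, .bottom), (⟨1⟩, [⟨[G.start], hN⟩]))
  | accept : Transition hN ((⟨1⟩, none, .bottom), (⟨2⟩, []))
  | expand {τ : G.tables} {x : G.A} {g u w : G.BoundedWord N} (hg : g.1 = x :: w.1)
      (h : τ.1.Replaces x u.1) :
      Transition hN ((⟨1⟩, none, .letters (some τ) g), (⟨1⟩, [u, w]))
  | pop {d : Option G.tables} {g : G.BoundedWord N} (hg : g.1 = []) :
      Transition hN ((⟨1⟩, none, .letters d g), (⟨1⟩, []))
  | read {a : σ} {g w : G.BoundedWord N} (hg : g.1 = G.terminal a :: w.1) :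
      Transition hN ((⟨1⟩, some a, .letters none g), (⟨1⟩, [w]))

/-- A check-stack pushdown automaton that carries out the derivations of `G` depth first. -/
abbrev toCSPD [Finite σ] (hN : 1 ≤ N) : CSPDAutomaton σ :=
  have := G.finite_A
  have : Finite (G.BoundedWord N) := List.finite_length_le G.A N
  have : Finite G.tables := G.finite_tables
  { Q := ULift.{u} (Fin 3)
    Γ := G.BoundedWord N
    Δ := Option G.tables
    finite_Q := inferInstance
    finite_Γ := inferInstance
    finite_Δ := inferInstance
    checkStacks := Language.map some G.control * {[none]}
    regular_checkStacks :=
      (G.regular_control.map some).mul (Language.isRegular_singleton_singleton none)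
    θ := {t | G.Transition N hN t}
    finite_θ := by
      refine (Set.finite_univ.prod (Set.finite_univ.prod
        (List.finite_length_le (G.BoundedWord N) 2))).subset ?_
      rintro _ (_ | _ | _ | _ | _) <;> exact ⟨trivial, trivial, by simp⟩
    q₀ := ⟨0⟩
    F := {⟨2⟩} }

/-- `G.Yields N v s y` holds if the contents `s` of the pushdown can be rewritten to the word `y`,
each letter of `s` by the part of `v` from its height upwards. -/
def Yields (v : List G.tables) : List (G.BoundedWord N) → List σ → Prop
  | [], y => y = []
  | g :: s, y => ∃ z y', y = z ++ y' ∧ s.length ≤ v.length ∧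
      G.Derives (v.drop s.length) g.1 (z.map G.terminal) ∧ Yields v s y'

variable {G N}

theorem getElem?_map_some_append {α : Type*} {v : List α} {i : ℕ} {d : Option α}
    (h : (v.map some ++ [none])[i]? = some d) :
    (∃ τ, d = some τ ∧ v[i]? = some τ) ∨ d = none ∧ i = v.length := by
  rcases lt_trichotomy i v.length with hi | hi | hi
  · rw [List.getElem?_append_left (by simpa using hi)] at h
    left
    simpa [hi, eq_comm] using h
  · right
    subst hi
    simpa [eq_comm] using h
  · rw [List.getElem?_eq_none (by simp; omega)] at h
    cases h

theorem drop_eq_cons_of_getElem? {α : Type*} {v : List α} {i : ℕ} {a : α} (h : v[i]? = some a) :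
    v.drop i = a :: v.drop (i + 1) := by
  obtain ⟨hi, rfl⟩ := List.getElem?_eq_some_iff.1 h
  exact List.drop_eq_getElem_cons hi

/-- Soundness of the simulation, by induction backwards from acceptance: undoing a move preserves
the invariant attached to each of the three states. -/
theorem derives_or_yields_of_reaches [Finite σ] (hN : 1 ≤ N) {v : List G.tables}
    {κ κ' : (G.toCSPD N hN).Config} (hκ' : κ'.state = (⟨2⟩ : ULift (Fin 3)) ∧ κ'.input = [])
    (h : Relation.ReflTransGen ((G.toCSPD N hN).Step (v.map some ++ [none])) κ κ') :
    (κ.state = (⟨0⟩ : ULift (Fin 3)) → κ.pushdown = [] →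
      G.Derives v [G.start] (κ.input.map G.terminal)) ∧
    (κ.state = (⟨1⟩ : ULift (Fin 3)) → G.Yields N v κ.pushdown κ.input) ∧
    (κ.state = (⟨2⟩ : ULift (Fin 3)) → κ.input = []) := by
  have h01 : (⟨0⟩ : ULift (Fin 3)) ≠ ⟨1⟩ := by simp [ULift.ext_iff]
  have h02 : (⟨0⟩ : ULift (Fin 3)) ≠ ⟨2⟩ := by simp [ULift.ext_iff]
  have h12 : (⟨1⟩ : ULift (Fin 3)) ≠ ⟨2⟩ := by simp [ULift.ext_iff]
  induction h using Relation.ReflTransGen.head_induction_on with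
  | refl =>
    obtain ⟨h₁, h₂⟩ := hκ'
    rw [h₁, h₂]
    exact ⟨fun h => absurd h.symm h02, fun h => absurd h.symm h12, fun _ => rfl⟩
  | head hs _ ih =>
    obtain ⟨ih₀, ih₁, ih₂⟩ := ih
    cases hs with
    | bottom h =>
      cases h with
      | start =>
        refine ⟨fun _ _ => ?_, fun h => absurd h h01, fun h => absurd h h02⟩
        obtain ⟨z, y, hy, -, hz, rfl⟩ := ih₁ rfl
        simp only [List.append_nil] at hy
        simpa [hy] using hz
      | accept =>
        refine ⟨fun h => absurd h.symm h01, fun _ => ih₂ rfl, fun h => absurd h h12⟩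
    | free h => cases h
    | @letters _ _ _ _ _ _ _ s h hd =>
      cases h with
      | @expand τ x g u w hg h =>
        refine ⟨fun h => absurd h.symm h01, fun _ => ?_, fun h => absurd h h12⟩
        -- The replacement `u` stands one level above `w`, so it is one table ahead; `w` keeps the
        -- height of the expanded word.
        obtain ⟨z₁, _, hy, hl, hz₁, z₂, y', rfl, hl', hz₂, hs⟩ := ih₁ rfl
        change s.length ≤ v.length at hl'
        change G.Derives (v.drop (s.length + 1)) u.1 _ at hz₁
        change G.Derives (v.drop s.length) w.1 _ at hz₂
        obtain ⟨τ', h₁, h₂⟩ | ⟨h₁, -⟩ := getElem?_map_some_append hd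
        · cases h₁
          refine ⟨z₁ ++ z₂, y', hy.trans (List.append_assoc ..).symm, hl', ?_, hs⟩
          rw [hg, ← List.singleton_append, derives_append_iff]
          refine ⟨z₁.map G.terminal, z₂.map G.terminal, List.map_append, ?_, hz₂⟩
          rw [drop_eq_cons_of_getElem? h₂]
          exact ⟨_, ET0LTable.step_singleton h, hz₁⟩
        · cases h₁
      | pop hg =>
        refine ⟨fun h => absurd h.symm h01, fun _ => ?_, fun h => absurd h h12⟩
        refine ⟨[], _, rfl, ?_, ?_, ih₁ rfl⟩
        -- The marker makes the check-stack one longer than `v`, so height `v.length` is still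
        -- allowed.
        · obtain ⟨hi, -⟩ := List.getElem?_eq_some_iff.1 hd
          simp only [List.length_append, List.length_map, List.length_singleton] at hi
          exact Nat.lt_succ_iff.1 hi
        · rw [hg, derives_nil_iff]; rfl
      | @read a g w hg =>
        refine ⟨fun h => absurd h.symm h01, fun _ => ?_, fun h => absurd h h12⟩
        obtain ⟨z, y', hy, hl, hz, hs⟩ := ih₁ rfl
        change G.Derives (v.drop s.length) w.1 _ at hz
        obtain ⟨τ', h₁, h₂⟩ | ⟨-, hi⟩ := getElem?_map_some_append hd
        · cases h₁
        · refine ⟨a :: z, y', congrArg (a :: ·) hy, hl, ?_, hs⟩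
          rw [hi, List.drop_length] at hz ⊢
          rw [hg]
          exact congrArg (G.terminal a :: ·) hz

/-- Completeness: an outer induction on the tables still to be applied handles a replacement one
level up, and an inner induction on `w` handles the remaining letters at the same level. With no
table left, the induction is on the terminal word read. -/
theorem reaches_of_derives [Finite σ] (hN : 1 ≤ N)
    (hG : ∀ τ ∈ G.tables, ∀ x u, τ.Replaces x u → u.length ≤ N) {v t : List G.tables}
    {s : List (G.BoundedWord N)} (ht : v.drop s.length = t) (hs : s.length ≤ v.length)
    {w : List G.A} (hw : w.length ≤ N) {z : List σ} (h : G.Derives t w (z.map G.terminal))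
    (y : List σ) :
    Relation.ReflTransGen ((G.toCSPD N hN).Step (v.map some ++ [none]))
      ⟨(⟨1⟩ : ULift (Fin 3)), z ++ y, (⟨w, hw⟩ : G.BoundedWord N) :: s⟩
      ⟨(⟨1⟩ : ULift (Fin 3)), y, s⟩ := by
  have pop (s : List (G.BoundedWord N)) (hs : s.length ≤ v.length) (h0) (y : List σ) :
      (G.toCSPD N hN).Step (v.map some ++ [none])
      ⟨(⟨1⟩ : ULift (Fin 3)), y, (⟨[], h0⟩ : G.BoundedWord N) :: s⟩
      ⟨(⟨1⟩ : ULift (Fin 3)), y, s⟩ :=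
    CSPDAutomaton.Step.letters (M := G.toCSPD N hN) (a := none) (u := [])
      (Transition.pop rfl) (List.getElem?_eq_getElem (by simp; omega))
  induction t generalizing s w z y with
  | nil =>
    obtain rfl : w = z.map G.terminal := h
    have hi : s.length = v.length :=
      le_antisymm hs (List.drop_eq_nil_iff.1 ht)
    induction z with
    | nil => exact .single (pop s hs _ y)
    | cons a z ih =>
      have hw' : (z.map G.terminal).length ≤ N := by simp at hw ⊢; omega
      refine .head ?_ (ih hw')
      exact CSPDAutomaton.Step.letters (M := G.toCSPD N hN) (a := some a)
        (u := [⟨z.map G.terminal, hw'⟩]) (Transition.read rfl) (by simp [hi])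
  | cons τ t ih =>
    have hi : s.length < v.length := by
      by_contra hi
      rw [List.drop_eq_nil_iff.2 (not_lt.1 hi)] at ht
      cases ht
    rw [List.drop_eq_getElem_cons hi, List.cons.injEq] at ht
    obtain ⟨hτ, ht⟩ := ht
    induction w generalizing z with
    | nil =>
      obtain rfl : z = [] := by simpa using derives_nil_iff.1 h
      exact .single (pop s hs _ y)
    | cons x w ihw =>
      obtain ⟨_, hst, h⟩ := h
      obtain ⟨u, w', rfl, hx, hst⟩ := ET0LTable.step_cons_iff.1 hst
      obtain ⟨u₁, u₂, hz, h₁, h₂⟩ := derives_append_iff.1 h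
      obtain ⟨z₁, z₂, rfl, rfl, rfl⟩ := List.map_eq_append_iff.1 hz
      have hu : u.length ≤ N := hG τ.1 τ.2 x u hx
      have hw' : w.length ≤ N := by simp at hw; omega
      rw [List.append_assoc]
      refine .head ?_ ((ih (s := ⟨w, hw'⟩ :: s) ht hi hu h₁ (z₂ ++ y)).trans
        (ihw hw' (z := z₂) ⟨w', hst, h₂⟩))
      refine CSPDAutomaton.Step.letters (M := G.toCSPD N hN) (a := none)
        (d := some τ) (u := [⟨u, hu⟩, ⟨w, hw'⟩]) (Transition.expand rfl hx) ?_
      rw [List.getElem?_append_left (by simpa using hi)]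
      simp [hi, hτ]

theorem language_toCSPD [Finite σ] (hN : 1 ≤ N)
    (hG : ∀ τ ∈ G.tables, ∀ x u, τ.Replaces x u → u.length ≤ N) :
    (G.toCSPD N hN).language = G.language := by
  ext x
  constructor
  · rintro ⟨c, hc, q, rfl, s, h⟩
    obtain ⟨_, ⟨v, hv, rfl⟩, _, rfl, rfl⟩ := Language.mem_mul.1 hc
    exact ⟨v, hv, (derives_or_yields_of_reaches hN ⟨rfl, rfl⟩ h).1 rfl rfl⟩
  · rintro ⟨v, hv, h⟩
    refine ⟨v.map some ++ [none], Language.mem_mul.2 ⟨_, ⟨v, hv, rfl⟩, _, rfl, rfl⟩,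
      (⟨2⟩ : ULift (Fin 3)), rfl, [], ?_⟩
    have h1 := reaches_of_derives hN hG (s := []) rfl (Nat.zero_le _) (w := [G.start]) hN h []
    rw [List.append_nil] at h1
    refine .head ?_ (h1.tail ?_)
    · exact CSPDAutomaton.Step.bottom (M := G.toCSPD N hN) (a := none) Transition.start
    · exact CSPDAutomaton.Step.bottom (M := G.toCSPD N hN) (a := none) Transition.accept

end ET0LGrammar

theorem IsET0L.isCSPDRecognisable {σ : Type u} [Finite σ] {L : Language σ} (hL : IsET0L L) :
    IsCSPDRecognisable L := by
  obtain ⟨G, rfl⟩ := hL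
  have := G.finite_A
  obtain ⟨N, hN, hG⟩ := ET0LTable.exists_length_le G.finite_tables
  exact ⟨G.toCSPD N hN, ET0LGrammar.language_toCSPD hN hG⟩

/-! ### Letter machines and the recursive structure of their runs -/

/-- A check-stack pushdown automaton in which every transition reads a letter on both stacks, and
which accepts, in the state `qf`, with an empty pushdown, having started with the one letter `g₀` on
its pushdown. -/
structure LetterMachine (σ : Type u) where
  /-- The states. -/
  Q : Type u
  /-- The alphabet for the pushdown. -/
  Γ : Type u
  /-- The alphabet for the check-stack. -/
  Δ : Type u
  finite_Q : Finite Q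
  finite_Γ : Finite Γ
  finite_Δ : Finite Δ
  /-- The language of allowed check-stacks. -/
  checkStacks : Language Δ
  regular_checkStacks : checkStacks.IsRegular
  /-- The transition relation. -/
  θ : Set ((Q × Option σ × Δ × Γ) × (Q × List Γ))
  finite_θ : θ.Finite
  /-- The start state. -/
  q₀ : Q
  /-- The accepting state. -/
  qf : Q
  /-- The initial letter on the pushdown. -/
  g₀ : Γ

namespace LetterMachine

variable {σ : Type u} (M : LetterMachine σ)

/-- One move of the machine with check-stack `c`; a configuration consists of the state, the
remaining input and the pushdown, from its top downwards. -/
inductive Step (c : List M.Δ) : M.Q × List σ × List M.Γ → M.Q × List σ × List M.Γ → Prop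
  | mk {p q : M.Q} {a : Option σ} {d : M.Δ} {g : M.Γ} {u s : List M.Γ} {x : List σ}
      (h : ((p, a, d, g), (q, u)) ∈ M.θ) (hd : getElem? c s.length = some d) :
      Step c (p, a.toList ++ x, g :: s) (q, x, u ++ s)

/-- The language recognised by the machine. -/
def language : Language σ :=
  {x | ∃ c ∈ M.checkStacks, Relation.ReflTransGen (M.Step c) (M.q₀, x, [M.g₀]) (M.qf, [], [])}

/-- `M.Pops c p w q y` holds if, when `c` is the part of the check-stack from the height of the
last letter of `w` upwards, the machine can get from the state `p` to the state `q` while consuming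
`y` and removing `w` from the pushdown. -/
inductive Pops : List M.Δ → M.Q → List M.Γ → M.Q → List σ → Prop
  | nil {c : List M.Δ} {p : M.Q} : Pops c p [] p []
  | snoc {c : List M.Δ} {p q r r' : M.Q} {w u : List M.Γ} {a : Option σ} {d : M.Δ} {g : M.Γ}
      {y y' : List σ} (hw : Pops c p w r y) (h : ((r, a, d, g), (r', u)) ∈ M.θ)
      (hu : Pops (d :: c) r' u q y') : Pops (d :: c) p (w ++ [g]) q (y ++ (a.toList ++ y'))

variable {M}

theorem pops_nil_iff {c : List M.Δ} {p q : M.Q} {y : List σ} :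
    M.Pops c p [] q y ↔ p = q ∧ y = [] := by
  constructor
  · intro h
    generalize hl : ([] : List M.Γ) = l at h
    cases h with
    | nil => exact ⟨rfl, rfl⟩
    | snoc => simp at hl
  · rintro ⟨rfl, rfl⟩; exact .nil

theorem pops_concat_iff {c : List M.Δ} {p q : M.Q} {w : List M.Γ} {g : M.Γ} {y : List σ} :
    M.Pops c p (w ++ [g]) q y ↔ ∃ d c' r r' a u y₁ y₂, c = d :: c' ∧ y = y₁ ++ (a.toList ++ y₂) ∧
      M.Pops c' p w r y₁ ∧ ((r, a, d, g), (r', u)) ∈ M.θ ∧ M.Pops (d :: c') r' u q y₂ := by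
  constructor
  · intro h
    generalize hl : w ++ [g] = l at h
    cases h with
    | nil => simp at hl
    | snoc hw h hu =>
      obtain ⟨rfl, hg⟩ := List.append_inj' hl rfl
      obtain rfl := List.singleton_inj.1 hg
      exact ⟨_, _, _, _, _, _, _, _, rfl, rfl, hw, h, hu⟩
  · rintro ⟨d, c', r, r', a, u, y₁, y₂, rfl, rfl, hw, h, hu⟩
    exact .snoc hw h hu

theorem Pops.ne_nil {c : List M.Δ} {p q : M.Q} {w : List M.Γ} {y : List σ} (h : M.Pops c p w q y)
    (hw : w ≠ []) : c ≠ [] := by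
  cases h with
  | nil => exact absurd rfl hw
  | snoc => simp

/-- `Pops` takes words apart at their lowest letter, whereas a move acts on the top. The letters
below are therefore peeled off from the bottom until the move is at the lowest position, where it is
an instance of the recursion. -/
theorem Pops.head {c : List M.Δ} {p p' q : M.Q} {a : Option σ} {d : M.Δ} {g : M.Γ}
    {u s : List M.Γ} {y : List σ} (h : ((p, a, d, g), (p', u)) ∈ M.θ)
    (hd : getElem? c s.length = some d) (hp : M.Pops c p' (u ++ s) q y) :
    M.Pops c p (g :: s) q (a.toList ++ y) := by
  induction s using List.reverseRecOn generalizing c q y with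
  | nil =>
    cases c with
    | nil => simp at hd
    | cons e c =>
      obtain rfl : e = d := by simpa using hd
      exact pops_concat_iff (w := []).2
        ⟨e, c, p, p', a, u, [], y, rfl, rfl, .nil, h, by simpa using hp⟩
  | append_singleton s g' ih =>
    rw [← List.append_assoc] at hp
    obtain ⟨e, c, r, r', b, v, y₁, y₂, rfl, rfl, h₁, h₂, h₃⟩ := pops_concat_iff.1 hp
    rw [← List.cons_append, ← List.append_assoc]
    exact .snoc (ih (by simpa using hd) h₁) h₂ h₃

theorem Pops.reaches {c : List M.Δ} {p q : M.Q} {w : List M.Γ} {y : List σ} (h : M.Pops c p w q y)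
    {c₀ : List M.Δ} {s : List M.Γ} (hc : c₀.drop s.length = c) (x : List σ) :
    Relation.ReflTransGen (M.Step c₀) (p, y ++ x, w ++ s) (q, x, s) := by
  induction h generalizing s x with
  | nil => exact .refl
  | @snoc c p q r r' w u a d g y y' hw h hu ih₁ ih₂ =>
    have hd : c₀[s.length]? = some d := by
      rw [← Nat.add_zero s.length, ← List.getElem?_drop, hc]; rfl
    -- While `w` is being removed, `g` lies below it, which shifts the visible part of the
    -- check-stack up by one.
    have h₁ := ih₁ (s := g :: s)
      (by rw [List.length_cons, ← List.drop_drop, hc]; rfl) (a.toList ++ (y' ++ x))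
    simpa using h₁.trans (.head (.mk h hd) (ih₂ hc x))

theorem pops_of_reaches {c : List M.Δ} {q : M.Q} {κ : M.Q × List σ × List M.Γ}
    (h : Relation.ReflTransGen (M.Step c) κ (q, [], [])) : M.Pops c κ.1 κ.2.2 q κ.2.1 := by
  induction h using Relation.ReflTransGen.head_induction_on with
  | refl => exact .nil
  | head hs _ ih =>
    cases hs with
    | mk h hd => exact .head h hd ih

theorem mem_language_iff {x : List σ} :
    x ∈ M.language ↔ ∃ c ∈ M.checkStacks, M.Pops c M.q₀ [M.g₀] M.qf x := by
  refine exists_congr fun c => and_congr_right fun _ => ⟨fun h => pops_of_reaches h, fun h => ?_⟩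
  simpa using h.reaches (s := []) (c₀ := c) rfl []

end LetterMachine

/-! ### From check-stack pushdown automata to letter machines -/

namespace CSPDAutomaton

variable {σ : Type u} (M : CSPDAutomaton σ)

/-- The transitions of `M.toLetterMachine`. The letter `none` at the bottom of the pushdown and the
letter `.inr false` at the bottom of the check-stack play the role of the bottom symbol, and
`.inr true` continues the check-stack above its top. In the state `none` the pushdown is emptied. -/
inductive LetterTransition : (Option M.Q × Option σ × (M.Δ ⊕ Bool) × Option M.Γ) ×
    (Option M.Q × List (Option M.Γ)) → Prop
  | bottom {p q : M.Q} {a : Option σ} {u : List M.Γ} (h : ((p, a, .bottom), (q, u)) ∈ M.θ) :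
      LetterTransition ((some p, a, .inr false, none), (some q, u.map some ++ [none]))
  | letters {p q : M.Q} {a : Option σ} {d : M.Δ} {g : M.Γ} {u : List M.Γ}
      (h : ((p, a, .letters d g), (q, u)) ∈ M.θ) :
      LetterTransition ((some p, a, .inl d, some g), (some q, u.map some))
  | free {p q : M.Q} {a : Option σ} {u : List M.Γ} {d : M.Δ ⊕ Bool} {g : Option M.Γ}
      (h : ((p, a, .free), (q, u)) ∈ M.θ) :
      LetterTransition ((some p, a, d, g), (some q, u.map some ++ [g]))
  | accept {p : M.Q} {d : M.Δ ⊕ Bool} {g : Option M.Γ} (h : p ∈ M.F) :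
      LetterTransition ((some p, none, d, g), (none, [g]))
  | pop {d : M.Δ ⊕ Bool} {g : Option M.Γ} : LetterTransition ((none, none, d, g), (none, []))

/-- A machine reading letters only that recognises the language of `M`. -/
abbrev toLetterMachine [Finite σ] : LetterMachine σ :=
  have := M.finite_Q
  have := M.finite_Γ
  have := M.finite_Δ
  { Q := Option M.Q
    Γ := Option M.Γ
    Δ := M.Δ ⊕ Bool
    finite_Q := inferInstance
    finite_Γ := inferInstance
    finite_Δ := inferInstance
    checkStacks := ({[Sum.inr false]} : Language (M.Δ ⊕ Bool)) *
      (Language.map Sum.inl M.checkStacks * Language.powers (Sum.inr true))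
    regular_checkStacks := (Language.isRegular_singleton_singleton _).mul
      ((M.regular_checkStacks.map _).mul (Language.isRegular_powers _))
    θ := {t | M.LetterTransition t}
    finite_θ := by
      obtain ⟨N, hN⟩ := (M.finite_θ.image fun t => t.2.2.length).bddAbove
      refine (Set.finite_univ.prod (Set.finite_univ.prod
        (List.finite_length_le (Option M.Γ) (N + 1)))).subset ?_
      rintro _ (h | h | h | h | _)
      · exact ⟨trivial, trivial, by simpa using hN ⟨_, h, rfl⟩⟩
      · exact ⟨trivial, trivial, by simpa using (hN ⟨_, h, rfl⟩).trans N.le_succ⟩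
      · exact ⟨trivial, trivial, by simpa using hN ⟨_, h, rfl⟩⟩
      · exact ⟨trivial, trivial, by simp⟩
      · exact ⟨trivial, trivial, by simp⟩
    q₀ := some M.q₀
    qf := none
    g₀ := none }

/-- The check-stack of `M.toLetterMachine` that corresponds to the check-stack `c` of `M`. -/
def paddedStack (c : List M.Δ) (n : ℕ) : List (M.Δ ⊕ Bool) :=
  .inr false :: (c.map .inl ++ List.replicate n (.inr true))

/-- The pushdown of `M.toLetterMachine` that corresponds to the pushdown `s` of `M`. -/
def markedPushdown (s : List M.Γ) : List (Option M.Γ) := s.map some ++ [none]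

variable {M}

theorem length_markedPushdown (s : List M.Γ) : (M.markedPushdown s).length = s.length + 1 := by
  simp [markedPushdown]

theorem markedPushdown_append (u s : List M.Γ) :
    M.markedPushdown (u ++ s) = u.map some ++ M.markedPushdown s := by
  simp [markedPushdown]

theorem length_paddedStack (c : List M.Δ) (n : ℕ) :
    (M.paddedStack c n).length = c.length + n + 1 := by
  simp [paddedStack]

theorem getElem?_paddedStack_succ {c : List M.Δ} {n i : ℕ} {d : M.Δ} :
    (M.paddedStack c n)[i + 1]? = some (.inl d) ↔ getElem? c i = some d := by
  rw [paddedStack, List.getElem?_cons_succ, List.getElem?_append]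
  split_ifs with h
  · simp
  · rw [List.getElem?_replicate, List.getElem?_eq_none (by simpa using h)]
    split_ifs <;> simp

theorem pops_none [Finite σ] {c : List (M.Δ ⊕ Bool)} {w : List (Option M.Γ)}
    (h : w.length ≤ c.length) : M.toLetterMachine.Pops c none w none [] := by
  induction w with
  | nil => exact .nil
  | cons g w ih =>
    exact LetterMachine.Pops.head (M := M.toLetterMachine) (a := none) (u := [])
      LetterTransition.pop (List.getElem?_eq_getElem h) (ih (Nat.le_of_succ_le h))

/-- A finite run visits finitely many heights, so enough padding gives every free move a check-stack
letter to read. Asking for all large `n` lets the bounds of successive moves be combined by a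
maximum. -/
theorem pops_of_reaches [Finite σ] {c : List M.Δ} {κ κ' : M.Config} (hF : κ'.state ∈ M.F)
    (hi : κ'.input = []) (h : Relation.ReflTransGen (M.Step c) κ κ') :
    ∃ n₀, ∀ n, n₀ ≤ n → M.toLetterMachine.Pops (M.paddedStack c n) (some κ.state)
      (M.markedPushdown κ.pushdown) none κ.input := by
  -- Free moves and acceptance both put back the letter they read, whichever it is, so one argument
  -- serves both.
  have free {c : List (M.Δ ⊕ Bool)} {p : M.Q} {q : Option M.Q} {a : Option σ}
      {u : List (Option M.Γ)} {s : List M.Γ} {y : List σ} (hs : s.length < c.length)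
      (hθ : ∀ d g, M.LetterTransition ((some p, a, d, g), (q, u ++ [g])))
      (hp : M.toLetterMachine.Pops c q (u ++ M.markedPushdown s) none y) :
      M.toLetterMachine.Pops c (some p) (M.markedPushdown s) none (a.toList ++ y) := by
    obtain ⟨g, s', hg⟩ := List.exists_cons_of_length_pos
      (l := M.markedPushdown s) (by simp [length_markedPushdown])
    have hl : s'.length = s.length := by
      have := congrArg List.length hg
      rw [length_markedPushdown] at this
      simpa using this.symm
    rw [hg] at hp ⊢
    refine LetterMachine.Pops.head (M := M.toLetterMachine) (hθ _ g)
      (List.getElem?_eq_getElem (hl.trans_lt hs)) ?_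
    rwa [List.append_assoc]
  induction h using Relation.ReflTransGen.head_induction_on with
  | refl =>
    refine ⟨κ'.pushdown.length, fun n hn => ?_⟩
    have hl : κ'.pushdown.length < (M.paddedStack c n).length := by
      rw [length_paddedStack]; omega
    rw [hi]
    refine free (a := none) (u := []) hl (fun d g => .accept hF) (pops_none ?_)
    rw [List.nil_append, length_markedPushdown]
    exact hl
  | head hs _ ih =>
    obtain ⟨n₀, ih⟩ := ih
    cases hs with
    | @bottom p q a u x h =>
      refine ⟨n₀, fun n hn => ?_⟩
      exact LetterMachine.Pops.head (M := M.toLetterMachine) (s := [])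
        (LetterTransition.bottom h) rfl (by simpa [markedPushdown] using ih n hn)
    | @letters p q a d g u x s h hd =>
      refine ⟨n₀, fun n hn => ?_⟩
      refine LetterMachine.Pops.head (M := M.toLetterMachine) (s := M.markedPushdown s)
        (LetterTransition.letters h) ?_ (by simpa [markedPushdown] using ih n hn)
      rw [length_markedPushdown]
      exact getElem?_paddedStack_succ.2 hd
    | @free p q a u x s h =>
      refine ⟨max n₀ s.length, fun n hn => ?_⟩
      refine free (u := u.map some) ?_ (fun d g => .free h) ?_
      · rw [length_paddedStack]
        exact Nat.lt_succ_of_le ((le_of_max_le_right hn).trans (Nat.le_add_left _ _))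
      · rw [← markedPushdown_append]
        exact ih n (le_of_max_le_left hn)

/-- Until acceptance every move preserves the form of a marked pushdown, with `none` at its bottom
only, and so comes from a move of `M`. The emptying state consumes nothing, so the input is already
exhausted on entering it. -/
theorem reaches_of_letter_reaches [Finite σ] {c : List M.Δ} {n : ℕ}
    {κ κ' : M.toLetterMachine.Q × List σ × List M.toLetterMachine.Γ} (hκ' : κ'.1 = none)
    (hi : κ'.2.1 = [])
    (h : Relation.ReflTransGen (M.toLetterMachine.Step (M.paddedStack c n)) κ κ') :
    (κ.1 = none → κ.2.1 = []) ∧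
    ∀ p s, κ.1 = some p → κ.2.2 = M.markedPushdown s → ∃ q ∈ M.F, ∃ s',
      Relation.ReflTransGen (M.Step c) ⟨p, κ.2.1, s⟩ ⟨q, [], s'⟩ := by
  induction h using Relation.ReflTransGen.head_induction_on with
  | refl => exact ⟨fun _ => hi, fun p s hp => by rw [hκ'] at hp; cases hp⟩
  | head hs _ ih =>
    obtain ⟨ih₀, ih₁⟩ := ih
    cases hs with
    | @mk _ _ _ _ _ _ t x h hd =>
      cases h with
      | pop => exact ⟨ih₀, fun p s hp => by cases hp⟩
      | accept h =>
        refine ⟨fun h => (by cases h), fun p s hp _ => ?_⟩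
        obtain rfl := Option.some.inj hp
        obtain rfl : x = [] := ih₀ rfl
        exact ⟨_, h, s, .refl⟩
      | @bottom p q a u h =>
        refine ⟨fun h => (by cases h), fun p s hp hs => ?_⟩
        obtain rfl := Option.some.inj hp
        cases s with
        | cons g s => simp [markedPushdown] at hs
        | nil =>
          obtain rfl : t = [] := by simpa [markedPushdown] using hs
          obtain ⟨q', hq', s', h'⟩ := ih₁ q u rfl (by simp [markedPushdown])
          exact ⟨q', hq', s', .head (.bottom h) h'⟩
      | @letters p q a d g u h =>
        refine ⟨fun h => (by cases h), fun p s hp hs => ?_⟩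
        obtain rfl := Option.some.inj hp
        cases s with
        | nil => simp [markedPushdown] at hs
        | cons g' s =>
          obtain ⟨hg, rfl⟩ : some g = some g' ∧ t = M.markedPushdown s := by
            simpa [markedPushdown] using hs
          obtain rfl := Option.some.inj hg
          obtain ⟨q', hq', s', h'⟩ := ih₁ q (u ++ s) rfl (markedPushdown_append u s).symm
          -- The bottom letters shift both stacks by one, so the heights still agree.
          rw [length_markedPushdown] at hd
          exact ⟨q', hq', s', .head (.letters h (getElem?_paddedStack_succ.1 hd)) h'⟩
      | @free p q a u d g h =>
        refine ⟨fun h => (by cases h), fun p s hp hs => ?_⟩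
        obtain rfl := Option.some.inj hp
        obtain ⟨q', hq', s', h'⟩ := ih₁ q (u ++ s) rfl (by
          rw [markedPushdown_append, ← hs]; simp)
        exact ⟨q', hq', s', .head (.free h) h'⟩

theorem language_toLetterMachine [Finite σ] : M.toLetterMachine.language = M.language := by
  ext x
  constructor
  · rintro ⟨_, hc, h⟩
    obtain ⟨_, rfl, _, hc', rfl⟩ := Language.mem_mul.1 hc
    obtain ⟨_, ⟨c, hcM, rfl⟩, _, ⟨n, rfl⟩, rfl⟩ := Language.mem_mul.1 hc'
    exact ⟨c, hcM, (reaches_of_letter_reaches (c := c) (n := n) rfl rfl h).2 _ [] rfl rfl⟩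
  · rintro ⟨c, hc, q, hq, s, h⟩
    obtain ⟨n, hn⟩ := pops_of_reaches hq rfl h
    refine LetterMachine.mem_language_iff.2 ⟨M.paddedStack c n, ?_, hn n le_rfl⟩
    exact Language.mem_mul.2 ⟨_, rfl, _, Language.mem_mul.2 ⟨_, ⟨c, hc, rfl⟩, _, ⟨n, rfl⟩, rfl⟩, rfl⟩

end CSPDAutomaton

/-! ### The grammar of a letter machine -/

namespace LetterMachine

variable {σ : Type u} (M : LetterMachine σ) (N : ℕ)

/-- The pushdown words of bounded length. -/
abbrev BoundedWord : Type u := {w : List M.Γ // w.length ≤ N}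

/-- The non-terminals of the grammar of the machine: a symbol for failure, and the symbols
`some (b, p, w, q)`, from which are derived the inputs on which the machine gets from `p` to `q`
while removing `w` from the pushdown. If `b` is `true`, the last letter of `w` stands one higher
than the tables have reached. -/
abbrev NonTerminal : Type u := Option (Bool × M.Q × M.BoundedWord N × M.Q)

/-- The rules of the table that simulates moves for which `d` is seen on the check-stack. -/
inductive StayRule (d : M.Δ) : (σ ⊕ M.NonTerminal N) × List (σ ⊕ M.NonTerminal N) → Prop
  | refl (X : M.NonTerminal N) : StayRule d (.inr X, [.inr X])
  | erase {p : M.Q} {w : M.BoundedWord N} (hw : w.1 = []) :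
      StayRule d (.inr (some (false, p, w, p)), [])
  | expand {p q r r' : M.Q} {w w' u : M.BoundedWord N} {a : Option σ} {g : M.Γ}
      (hw : w.1 = w'.1 ++ [g]) (h : ((r, a, d, g), (r', u.1)) ∈ M.θ) :
      StayRule d (.inr (some (false, p, w, q)),
        [.inr (some (true, p, w', r))] ++ (a.toList.map .inl ++ [.inr (some (false, r', u, q))]))

/-- The rules of the table that moves up by one on the check-stack. -/
inductive PromoteRule : (σ ⊕ M.NonTerminal N) × List (σ ⊕ M.NonTerminal N) → Prop
  | up {p q : M.Q} {w : M.BoundedWord N} :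
      PromoteRule (.inr (some (true, p, w, q)), [.inr (some (false, p, w, q))])
  | erase {p : M.Q} {w : M.BoundedWord N} (hw : w.1 = []) :
      PromoteRule (.inr (some (true, p, w, p)), [])
  | fail {p q : M.Q} {w : M.BoundedWord N} :
      PromoteRule (.inr (some (false, p, w, q)), [.inr none])
  | none : PromoteRule (.inr none, [.inr none])

theorem finite_symbol [Finite σ] : Finite (σ ⊕ M.NonTerminal N) :=
  have := M.finite_Q
  have := M.finite_Γ
  have : Finite (M.BoundedWord N) := List.finite_length_le M.Γ N
  inferInstance

section Finite

variable [Finite σ]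

/-- The table that simulates moves for which `d` is seen on the check-stack. -/
def stayTable (d : M.Δ) : ET0LTable (σ ⊕ M.NonTerminal N) (Set.range .inr) where
  rules := {t | M.StayRule N d t}
  finite_rules := by
    have := M.finite_symbol N
    refine (Set.finite_univ.prod (List.finite_length_le (σ ⊕ M.NonTerminal N) 3)).subset ?_
    rintro _ (_ | _ | @⟨_, _, _, _, _, _, _, _ | _⟩) <;> exact ⟨trivial, by simp⟩
  left_mem := by rintro _ (_ | _ | _) <;> exact ⟨_, rfl⟩
  exists_rule := by
    rintro _ ⟨X, rfl⟩
    exact ⟨_, .refl X⟩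

/-- The table that moves up by one on the check-stack. -/
def promoteTable : ET0LTable (σ ⊕ M.NonTerminal N) (Set.range .inr) where
  rules := {t | M.PromoteRule N t}
  finite_rules := by
    have := M.finite_symbol N
    refine (Set.finite_univ.prod (List.finite_length_le (σ ⊕ M.NonTerminal N) 1)).subset ?_
    rintro _ (_ | _ | _ | _) <;> exact ⟨trivial, by simp⟩
  left_mem := by rintro _ (_ | _ | _ | _) <;> exact ⟨_, rfl⟩
  exists_rule := by
    rintro _ ⟨_ | ⟨_ | _, p, w, q⟩, rfl⟩
    · exact ⟨_, .none⟩
    · exact ⟨_, .fail⟩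
    · exact ⟨_, .up⟩

/-- The tables of the grammar of the machine. -/
def table : Option M.Δ → ET0LTable (σ ⊕ M.NonTerminal N) (Set.range .inr)
  | some d => M.stayTable N d
  | none => M.promoteTable N

/-- The tables as members of the set of tables. -/
def tableIndex (o : Option M.Δ) : Set.range (M.table N) := ⟨M.table N o, o, rfl⟩

/-- A grammar for the language of the machine. While the height of the tables is that of a letter
`d` of the check-stack, the table of `d` is applied any number of times. -/
def toET0LGrammar (hN : 1 ≤ N) : ET0LGrammar σ :=
  have := M.finite_Δ
  { A := σ ⊕ M.NonTerminal N
    finite_A := M.finite_symbol N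
    terminal := .inl
    V := Set.range .inr
    terminal_or_mem := by rintro (a | X); exacts [.inl ⟨a, rfl⟩, .inr ⟨X, rfl⟩]
    tables := Set.range (M.table N)
    finite_tables := Set.finite_range _
    control := {t | ∃ c ∈ M.checkStacks,
      Language.Interleaved (fun d => M.tableIndex N (some d)) (M.tableIndex N none) c t}
    regular_control := M.regular_checkStacks.interleaved _ _
    start := .inr (some (false, M.q₀, ⟨[M.g₀], hN⟩, M.qf))
    start_mem := ⟨_, rfl⟩ }

end Finite

/-- `M.Means N c X y` holds if the symbol `X` stands for the word `y` when `c` is the part of the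
check-stack from the height of the tables upwards. -/
def Means (c : List M.Δ) : σ ⊕ M.NonTerminal N → List σ → Prop
  | .inl a, y => y = [a]
  | .inr none, _ => False
  | .inr (some (false, p, w, q)), y => c ≠ [] ∧ M.Pops c p w.1 q y
  | .inr (some (true, p, w, q)), y => ∃ d c', c = d :: c' ∧ M.Pops c' p w.1 q y

/-- The extension of `M.Means N c` to words. -/
def MeansWord (c : List M.Δ) : List (σ ⊕ M.NonTerminal N) → List σ → Prop
  | [], y => y = []
  | X :: w, y => ∃ y₁ y₂, y = y₁ ++ y₂ ∧ M.Means N c X y₁ ∧ MeansWord c w y₂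

variable {M N}

theorem meansWord_append_iff {c : List M.Δ} {w₁ w₂ : List (σ ⊕ M.NonTerminal N)} {y : List σ} :
    M.MeansWord N c (w₁ ++ w₂) y ↔
      ∃ y₁ y₂, y = y₁ ++ y₂ ∧ M.MeansWord N c w₁ y₁ ∧ M.MeansWord N c w₂ y₂ := by
  induction w₁ generalizing y with
  | nil => simp [MeansWord]
  | cons X w₁ ih =>
    simp only [List.cons_append, MeansWord, ih]
    constructor
    · rintro ⟨y₁, _, rfl, h₁, y₂, y₃, rfl, h₂, h₃⟩
      exact ⟨y₁ ++ y₂, y₃, by simp, ⟨y₁, y₂, rfl, h₁, h₂⟩, h₃⟩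
    · rintro ⟨_, y₃, rfl, ⟨y₁, y₂, rfl, h₁, h₂⟩, h₃⟩
      exact ⟨y₁, y₂ ++ y₃, by simp, h₁, y₂, y₃, rfl, h₂, h₃⟩

theorem meansWord_singleton_iff {c : List M.Δ} {X : σ ⊕ M.NonTerminal N} {y : List σ} :
    M.MeansWord N c [X] y ↔ M.Means N c X y := by
  simp [MeansWord]

theorem meansWord_map_inl_iff {c : List M.Δ} {x y : List σ} :
    M.MeansWord N c (x.map .inl) y ↔ y = x := by
  induction x generalizing y with
  | nil => rfl
  | cons a x ih =>
    simp only [List.map_cons, MeansWord, ih, Means]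
    constructor
    · rintro ⟨_, _, rfl, rfl, rfl⟩; rfl
    · rintro rfl; exact ⟨[a], x, rfl, rfl, rfl⟩

/-- Above the top of the check-stack no table remains, so no non-terminal may have a meaning. This
is why `Means` requires `c ≠ []` for the flag `false`: an empty word still to be removed could no
longer be erased. -/
theorem MeansWord.eq_map_inl {w : List (σ ⊕ M.NonTerminal N)} {y : List σ}
    (h : M.MeansWord N [] w y) : w = y.map .inl := by
  induction w generalizing y with
  | nil =>
    obtain rfl : y = [] := h
    rfl
  | cons X w ih =>
    obtain ⟨y₁, y₂, rfl, hX, hw⟩ := h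
    rw [ih hw]
    rcases X with a | _ | ⟨_ | _, p, w, q⟩
    · obtain rfl : y₁ = [a] := hX
      rfl
    · exact hX.elim
    · exact absurd rfl hX.1
    · obtain ⟨d, c', h, -⟩ := hX
      cases h

/-- Reduces soundness of a table to single letters. The two check-stacks coincide for a stay table
and differ by one letter for the promotion. -/
theorem meansWord_of_step {V : Set (σ ⊕ M.NonTerminal N)} {τ : ET0LTable (σ ⊕ M.NonTerminal N) V}
    {c c' : List M.Δ} (hτ : ∀ X u y, τ.Replaces X u → M.MeansWord N c' u y → M.Means N c X y)
    {w w' : List (σ ⊕ M.NonTerminal N)} (h : τ.Step w w') {y : List σ}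
    (hy : M.MeansWord N c' w' y) : M.MeansWord N c w y := by
  induction h generalizing y with
  | nil => exact hy
  | cons hx _ ih =>
    obtain ⟨y₁, y₂, rfl, h₁, h₂⟩ := meansWord_append_iff.1 hy
    exact ⟨y₁, y₂, rfl, hτ _ _ _ hx h₁, ih h₂⟩

variable [Finite σ]

theorem means_of_stayTable_replaces {d : M.Δ} {c : List M.Δ} {X : σ ⊕ M.NonTerminal N}
    {u : List (σ ⊕ M.NonTerminal N)} {y : List σ} (h : (M.stayTable N d).Replaces X u)
    (hy : M.MeansWord N (d :: c) u y) : M.Means N (d :: c) X y := by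
  obtain ⟨-, h⟩ | ⟨-, rfl⟩ := h
  · cases h with
    | refl X => exact meansWord_singleton_iff.1 hy
    | erase hw =>
      obtain rfl : y = [] := hy
      exact ⟨by simp, by rw [hw]; exact .nil⟩
    | expand hw h =>
      obtain ⟨y₁, y₂, rfl, h₁, h₂⟩ := meansWord_append_iff.1 hy
      obtain ⟨_, y₃, rfl, h₃, h₄⟩ := meansWord_append_iff.1 h₂
      obtain ⟨_, _, he, h₁⟩ := meansWord_singleton_iff.1 h₁
      obtain ⟨rfl, rfl⟩ := List.cons.inj he
      obtain ⟨-, h₄⟩ := meansWord_singleton_iff.1 h₄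
      rw [meansWord_map_inl_iff.1 h₃]
      exact ⟨by simp, by rw [hw]; exact .snoc h₁ h h₄⟩
  · exact meansWord_singleton_iff.1 hy

theorem means_of_promoteTable_replaces {d : M.Δ} {c : List M.Δ} {X : σ ⊕ M.NonTerminal N}
    {u : List (σ ⊕ M.NonTerminal N)} {y : List σ} (h : (M.promoteTable N).Replaces X u)
    (hy : M.MeansWord N c u y) : M.Means N (d :: c) X y := by
  obtain ⟨-, h⟩ | ⟨hX, rfl⟩ := h
  · cases h with
    | up => exact ⟨d, c, rfl, (meansWord_singleton_iff.1 hy).2⟩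
    | erase hw =>
      obtain rfl : y = [] := hy
      exact ⟨d, c, rfl, by rw [hw]; exact .nil⟩
    -- A symbol left unfinished at its own height turns into the failure symbol, which stands for
    -- nothing.
    | fail => exact (meansWord_singleton_iff.1 hy).elim
    | none => exact (meansWord_singleton_iff.1 hy).elim
  · obtain a | X := X
    · exact meansWord_singleton_iff.1 hy
    · exact absurd ⟨X, rfl⟩ hX

theorem meansWord_of_derives {hN : 1 ≤ N} {c : List M.Δ} {t : List (Set.range (M.table N))}
    (ht : Language.Interleaved (fun d => M.tableIndex N (some d)) (M.tableIndex N none) c t)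
    {w : List (σ ⊕ M.NonTerminal N)} {x : List σ}
    (h : (M.toET0LGrammar N hN).Derives t w (x.map .inl)) : M.MeansWord N c w x := by
  induction ht generalizing w with
  | nil =>
    obtain rfl : w = x.map .inl := h
    exact meansWord_map_inl_iff.2 rfl
  | next _ ih =>
    obtain ⟨w₁, hs, h⟩ := h
    exact meansWord_of_step (fun _ _ _ => means_of_promoteTable_replaces) hs (ih h)
  | stay _ ih =>
    obtain ⟨w₁, hs, h⟩ := h
    exact meansWord_of_step (fun _ _ _ => means_of_stayTable_replaces) hs (ih h)

theorem stayTable_step_refl (d : M.Δ) (w : List (σ ⊕ M.NonTerminal N)) :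
    (M.stayTable N d).Step w w := by
  induction w with
  | nil => exact .nil
  | cons X w ih =>
    refine .cons (u := [X]) ?_ ih
    obtain a | X := X
    · exact .inr ⟨by simp, rfl⟩
    · exact .inl ⟨⟨X, rfl⟩, .refl X⟩

/-- `Advances d c w y` holds if `w` can be rewritten, by repeated use of the table of `d` and then
the table that moves up, to a word that stands for `y` at the next height. -/
def Advances (d : M.Δ) (c : List M.Δ) (w : List (σ ⊕ M.NonTerminal N)) (y : List σ) : Prop :=
  ∃ w₁ w₂, Relation.ReflTransGen (M.stayTable N d).Step w w₁ ∧ (M.promoteTable N).Step w₁ w₂ ∧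
    M.MeansWord N c w₂ y

/-- The two parts may need different numbers of stay steps. Since the stay table can leave any word
unchanged, each part idles while the other is rewritten, and both are then promoted together. -/
theorem Advances.append {d : M.Δ} {c : List M.Δ} {w w' : List (σ ⊕ M.NonTerminal N)}
    {y y' : List σ} (h : Advances d c w y) (h' : Advances d c w' y') :
    Advances d c (w ++ w') (y ++ y') := by
  obtain ⟨w₁, w₂, h₁, h₂, h₃⟩ := h
  obtain ⟨w₁', w₂', h₁', h₂', h₃'⟩ := h'
  refine ⟨w₁ ++ w₁', w₂ ++ w₂', ?_, h₂.append h₂', meansWord_append_iff.2 ⟨y, y', rfl, h₃, h₃'⟩⟩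
  exact (h₁.lift (· ++ w') fun _ _ h => h.append (stayTable_step_refl d w')).trans
    (h₁'.lift (w₁ ++ ·) fun _ _ h => (stayTable_step_refl d w₁).append h)

theorem Advances.of_replaces_stayTable {d : M.Δ} {c : List M.Δ} {X : σ ⊕ M.NonTerminal N}
    {u : List (σ ⊕ M.NonTerminal N)} {y : List σ} (h : (M.stayTable N d).Replaces X u)
    (hu : Advances d c u y) : Advances d c [X] y := by
  obtain ⟨w₁, w₂, h₁, h₂, h₃⟩ := hu
  exact ⟨w₁, w₂, .head (ET0LTable.step_singleton h) h₁, h₂, h₃⟩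

theorem Advances.of_replaces_promoteTable {d : M.Δ} {c : List M.Δ} {X : σ ⊕ M.NonTerminal N}
    {u : List (σ ⊕ M.NonTerminal N)} {y : List σ} (h : (M.promoteTable N).Replaces X u)
    (hu : M.MeansWord N c u y) : Advances d c [X] y :=
  ⟨_, _, .refl, ET0LTable.step_singleton h, hu⟩

theorem advances_nil (d : M.Δ) (c : List M.Δ) : Advances (N := N) d c [] [] :=
  ⟨_, _, .refl, .nil, rfl⟩

theorem advances_inl (d : M.Δ) (c : List M.Δ) (a : σ) : Advances (N := N) d c [.inl a] [a] :=
  .of_replaces_promoteTable (.inr ⟨by simp, rfl⟩) (meansWord_singleton_iff.2 rfl)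

theorem advances_true {d : M.Δ} {c : List M.Δ} {p q : M.Q} {w : M.BoundedWord N} {y : List σ}
    (h : M.Pops c p w.1 q y) : Advances d c [.inr (some (true, p, w, q))] y := by
  -- An empty word is erased rather than promoted, because `c` may be empty and the promoted symbol
  -- would then have no meaning.
  by_cases hw : w.1 = []
  · rw [hw] at h
    obtain ⟨rfl, rfl⟩ := pops_nil_iff.1 h
    exact .of_replaces_promoteTable (.inl ⟨⟨_, rfl⟩, .erase hw⟩) rfl
  · exact .of_replaces_promoteTable (.inl ⟨⟨_, rfl⟩, .up⟩)
      (meansWord_singleton_iff.2 ⟨h.ne_nil hw, h⟩)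

/-- Induction on the run: each expansion uses the move on the lowest letter. The word above it waits
for the promotion, and only the pushed word, at the same height, needs the induction hypothesis. -/
theorem advances_false (hM : ∀ t ∈ M.θ, t.2.2.length ≤ N) {d : M.Δ} {c : List M.Δ} {p q : M.Q}
    {w : M.BoundedWord N} {y : List σ} (h : M.Pops (d :: c) p w.1 q y) :
    Advances d c [.inr (some (false, p, w, q))] y := by
  obtain ⟨w, hw⟩ := w
  generalize hc : d :: c = c₀ at h
  change M.Pops c₀ p w q y at h
  induction h with
  | nil => exact .of_replaces_stayTable (.inl ⟨⟨_, rfl⟩, .erase rfl⟩) (advances_nil d c)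
  | @snoc c' p q r r' w u a d' g y y' hp h hu _ ih =>
    obtain ⟨rfl, rfl⟩ := List.cons.inj hc
    have hw' : w.length ≤ N := by simp at hw; omega
    have hu' : u.length ≤ N := hM _ h
    refine .of_replaces_stayTable
      (.inl ⟨⟨_, rfl⟩, .expand (w' := ⟨w, hw'⟩) (u := ⟨u, hu'⟩) rfl h⟩) ?_
    refine .append (advances_true hp) (.append ?_ (ih hu' rfl))
    cases a with
    | none => exact advances_nil d c
    | some a => exact advances_inl d c a

theorem MeansWord.advances (hM : ∀ t ∈ M.θ, t.2.2.length ≤ N) {d : M.Δ} {c : List M.Δ}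
    {w : List (σ ⊕ M.NonTerminal N)} {y : List σ} (h : M.MeansWord N (d :: c) w y) :
    Advances d c w y := by
  induction w generalizing y with
  | nil =>
    obtain rfl : y = [] := h
    exact advances_nil d c
  | cons X w ih =>
    obtain ⟨y₁, y₂, rfl, hX, hw⟩ := h
    refine .append (w := [X]) ?_ (ih hw)
    rcases X with a | _ | ⟨_ | _, p, w, q⟩
    · obtain rfl : y₁ = [a] := hX
      exact advances_inl d c a
    · exact hX.elim
    · exact advances_false hM hX.2
    · obtain ⟨_, _, he, hX⟩ := hX
      obtain ⟨rfl, rfl⟩ := List.cons.inj he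
      exact advances_true hX

theorem MeansWord.exists_derives (hN : 1 ≤ N) (hM : ∀ t ∈ M.θ, t.2.2.length ≤ N) {c : List M.Δ}
    {w : List (σ ⊕ M.NonTerminal N)} {y : List σ} (h : M.MeansWord N c w y) :
    ∃ t : List (Set.range (M.table N)),
      Language.Interleaved (fun d => M.tableIndex N (some d)) (M.tableIndex N none) c t ∧
      (M.toET0LGrammar N hN).Derives t w (y.map .inl) := by
  induction c generalizing w with
  | nil => exact ⟨[], .nil, h.eq_map_inl⟩
  | cons d c ih =>
    obtain ⟨w₁, w₂, h₁, h₂, h₃⟩ := h.advances hM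
    obtain ⟨t, ht, hd⟩ := ih h₃
    clear h
    -- Each stay step contributes one copy of the table of `d`, and the promotion closes the block.
    induction h₁ using Relation.ReflTransGen.head_induction_on with
    | refl => exact ⟨_ :: t, ht.next, w₂, h₂, hd⟩
    | head hs _ ih' =>
      obtain ⟨t', ht', hd'⟩ := ih'
      exact ⟨_ :: t', ht'.stay, _, hs, hd'⟩

theorem language_toET0LGrammar (hN : 1 ≤ N) (hM : ∀ t ∈ M.θ, t.2.2.length ≤ N) :
    (M.toET0LGrammar N hN).language = M.language := by
  ext x
  rw [mem_language_iff]
  constructor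
  · rintro ⟨t, ⟨c, hc, ht⟩, h⟩
    exact ⟨c, hc, (meansWord_singleton_iff.1 (meansWord_of_derives ht h)).2⟩
  · rintro ⟨c, hc, h⟩
    obtain ⟨t, ht, hd⟩ := MeansWord.exists_derives hN hM (c := c)
      (w := [.inr (some (false, M.q₀, ⟨[M.g₀], hN⟩, M.qf))])
      (meansWord_singleton_iff.2 ⟨h.ne_nil (by simp), h⟩)
    exact ⟨t, ⟨c, hc, ht⟩, hd⟩

end LetterMachine

theorem IsCSPDRecognisable.isET0L {σ : Type u} [Finite σ] {L : Language σ}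
    (hL : IsCSPDRecognisable L) : IsET0L L := by
  obtain ⟨M, rfl⟩ := hL
  obtain ⟨N, hN⟩ := (M.toLetterMachine.finite_θ.image fun t => t.2.2.length).bddAbove
  -- The bound must cover all pushed words and the one-letter initial pushdown.
  refine ⟨M.toLetterMachine.toET0LGrammar (max N 1) (le_max_right _ _), ?_⟩
  rw [LetterMachine.language_toET0LGrammar, CSPDAutomaton.language_toLetterMachine]
  exact fun t ht => le_max_of_le_left (hN ⟨t, ht, rfl⟩)

theorem theoremA1 {σ : Type u} [Finite σ] (L : Language σ) :
    IsET0L L ↔ IsCSPDRecognisable L := by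
  exact ⟨IsET0L.isCSPDRecognisable, IsCSPDRecognisable.isET0L⟩
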